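/- \textbf{Setting.} An election $E=(C,V)$ consists of a finite set $C$ of candidates and a finite sequence $V=(v_1,\dots,v_n)$ of voters, each with a strict linear preference order over $C$; $\mathrm{pos}_v(c)\in[m]=\{1,\dots,m\}$, $m=|C|$, is the position of candidate $c$ in the order of $v$ (the top candidate has position $1$). A multiwinner rule $\mathcal R$ assigns to each election $E=(C,V)$ and each $k$ with $1\le k\le |C|$ a family $\mathcal R(E,k)$ of $k$-element subsets (committees) of $C$. Let $[m]_k$ be the set of increasing sequences of $k$ elements of $[m]$; for a committee $S$ of size $k$, $\mathrm{pos}_v(S)\in[m]_k$ is the sequence of the positions of the members of $S$ in $v$, sorted increasingly. For $I=(i_1,\dots,i_k)$ and $J=(j_1,\dots,j_k)$ in $[m]_k$, $I$ weakly dominates $J$ if $i_t\le j_t$ for all $t$. A committee scoring function is a function $f_{m,k}\colon[m]_k\to[0,\infty)$ with $f_{m,k}(I)\ge f_{m,k}(J)$ whenever $I$ weakly dominates $J$. Given a family $f=(f_{m,k})_{1\le k\le m}$ of committee scoring functions, the committee scoring rule $\mathcal R_f$ outputs, for $E=(C,V)$ and $k$, all size-$k$ committees $S$ that maximize $\sum_{v\in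 V}f_{|C|,k}(\mathrm{pos}_v(S))$. A multiwinner rule $\mathcal R$ is committee-enlargement monotone if for every election $E=(C,V)$ and every $k$ with $1\le k<|C|$: (1) for each $W\in\mathcal R(E,k)$ there is $W'\in\mathcal R(E,k+1)$ with $W\subseteq W'$; and (2) for each $W\in\mathcal R(E,k+1)$ there is $W'\in\mathcal R(E,k)$ with $W'\subseteq W$. A family $g=(g_{m,k})_{1\le k\le m}$ of committee scoring functions is separable if for every $m$ there is a nonincreasing function $\gamma_m\colon[m]\to[0,\infty)$, not depending on $k$, such that $g_{m,k}(i_1,\dots,i_k)=\sum_{t=1}^k\gamma_m(i_t)$ for all $1\le k\le m$ and all $(i_1,\dots,i_k)\in[m]_k$. A rule $\mathcal R$ is separable if $\mathcal R=\mathcal R_g$ for some separable family $g$. \textbf{Theorem.} Let $f=(f_{m,k})_{1\le k\le m}$ be a family of committee scoring functions. The committee scoring rule $\mathcal R_f$ is committee-enlargement monotone if and only if it is separable. -/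

import Mathlib

universe u

namespace CommitteeScoring

/-- A preference order over the finite candidate set `C`, given as the bijection that sends each
candidate to its position. Positions are numbered from `0` (the top-ranked candidate) to `|C| - 1`,
so `i : Fin m` stands for the position `i + 1` of `[m] = {1, …, m}`. -/
abbrev PreferenceOrder (C : Type u) [Fintype C] : Type u := C ≃ Fin (Fintype.card C)

/-- An election with candidate set `C`: a finite sequence of voters, each with a preference
order over `C`. -/
structure Election (C : Type u) [Fintype C] where
  voters : List (PreferenceOrder C)

/-- Size-`k` committees: the `k`-element subsets of `C`. -/
abbrev Committee (C : Type u) (k : ℕ) : Type u := {S : Finset C // S.card = k}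

/-- A multiwinner voting rule: given an election with candidate set `C` and a committee size `k`,
`1 ≤ k ≤ |C|`, it returns a family of size-`k` committees (the ones that tie as winners). -/
def MultiwinnerRule : Type (u + 1) :=
  ∀ (C : Type u) [Fintype C], Election C →
    ∀ k : ℕ, 1 ≤ k → k ≤ Fintype.card C → Set (Committee C k)

/-- The set `[m]_k` of committee positions: increasing length-`k` sequences of positions. -/
abbrev CommitteePosition (m k : ℕ) : Type := Fin k ↪o Fin m

/-- `I` weakly dominates `J`: `i_t ≤ j_t` for every `t`. -/
def WeaklyDominates {m k : ℕ} (I J : CommitteePosition m k) : Prop := ∀ t : Fin k, I t ≤ J t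

/-- The committee position of `S` in the vote `v`: the positions of the members of `S`, sorted
in increasing order. -/
def committeePos {C : Type u} [Fintype C] {k : ℕ} (v : PreferenceOrder C) (S : Committee C k) :
    CommitteePosition (Fintype.card C) k :=
  (S.1.map v.toEmbedding).orderEmbOfFin (by rw [Finset.card_map]; exact S.2)

/-- A single-winner scoring function for `m` candidates: a nonincreasing function from positions
to the nonnegative reals. -/
structure SingleWinnerScoringFunction (m : ℕ) where
  toFun : Fin m → ℝ
  nonneg : ∀ i, 0 ≤ toFun i
  nonincreasing : ∀ i j, i ≤ j → toFun j ≤ toFun i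

/-- A committee scoring function for `m` candidates and committee size `k`: a function from
`[m]_k` to the nonnegative reals that is monotone with respect to weak dominance. -/
structure CommitteeScoringFunction (m k : ℕ) where
  toFun : CommitteePosition m k → ℝ
  nonneg : ∀ I, 0 ≤ toFun I
  monotone : ∀ I J, WeaklyDominates I J → toFun J ≤ toFun I

/-- A family `f = (f_{m,k})` of committee scoring functions. Only the members with `1 ≤ k ≤ m`
are ever used below. -/
abbrev ScoringFamily : Type := ∀ m k : ℕ, CommitteeScoringFunction m k

/-- The `f_{|C|,k}`-score of the committee `S` in the election `E`. -/
def score (f : ScoringFamily) {C : Type u} [Fintype C] (E : Election C) {k : ℕ}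
    (S : Committee C k) : ℝ :=
  (E.voters.map fun v => (f (Fintype.card C) k).toFun (committeePos v S)).sum

/-- The committee scoring rule `R_f`: it outputs all size-`k` committees with the highest
`f_{|C|,k}`-score. -/
def committeeScoringRule (f : ScoringFamily) : MultiwinnerRule.{u} :=
  fun C _ E k _ _ => {S | ∀ T : Committee C k, score f E T ≤ score f E S}

/-- Committee-enlargement monotonicity. For every `1 ≤ k < |C|` and every election:
each winning size-`k` committee is contained in some winning size-`(k+1)` committee, and each
winning size-`(k+1)` committee contains some winning size-`k` committee. -/
def IsCommitteeEnlargementMonotone (R : MultiwinnerRule.{u}) : Prop :=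
  ∀ (C : Type u) [Fintype C] (E : Election C) (k : ℕ) (hk : 1 ≤ k) (hkm : k < Fintype.card C),
    (∀ W ∈ R C E k hk hkm.le, ∃ W' ∈ R C E (k + 1) (Nat.le_add_left 1 k) hkm, W.1 ⊆ W'.1) ∧
    (∀ W ∈ R C E (k + 1) (Nat.le_add_left 1 k) hkm, ∃ W' ∈ R C E k hk hkm.le, W'.1 ⊆ W.1)

/-- The family `f` is separable: for each `m` there is one single-winner scoring function `γ_m`,
the same for all committee sizes, with `f_{m,k}(i_1, …, i_k) = γ_m(i_1) + ⋯ + γ_m(i_k)`. -/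
def ScoringFamily.IsSeparable (f : ScoringFamily) : Prop :=
  ∃ γ : ∀ m : ℕ, SingleWinnerScoringFunction m,
    ∀ m k : ℕ, 1 ≤ k → k ≤ m → ∀ I : CommitteePosition m k,
      (f m k).toFun I = ∑ t : Fin k, (γ m).toFun (I t)

/-- A rule is separable if it is the committee scoring rule defined through some separable family
of committee scoring functions. -/
def IsSeparableRule (R : MultiwinnerRule.{u}) : Prop :=
  ∃ g : ScoringFamily, ScoringFamily.IsSeparable g ∧ R = committeeScoringRule g

end CommitteeScoring

namespace CommitteeScoring

/-! Separable direction: the score of a committee is a sum of individual candidate scores, so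
winners are greedy: add a best outsider or drop a worst member.

Conversely, fix `m` and let `γ` be the scoring of single positions, i.e. `f_{m,1}`. By induction on
`k < m`, `f_{m,k}` equals `α * ∑ γ + β` on sets of size `k`, with `α > 0`; such a function selects
the same winners as `∑ γ`. The size `k = m` admits only one committee.

For the inductive step, an election is a weighting of the orders. By symmetry, weights that depend
only on the last candidate produce additive scores (`exists_weightedScore_last`). Adding such
weights to one order of weight `s` cancels the additive size-`k` score and installs any additive `t`
in its place; at size `k + 1` the score becomes, up to a constant, `s * φ + ρ * ∑ t`, where `φ` is
`f_{m,k+1}` minus a multiple of `∑ γ`. By monotonicity, some maximizer of this contains the strict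
size-`k` optimum of `t`. As `s` and `t` are arbitrary, an exchange argument makes `φ` constant
(`eq_of_forall_exists_superset`). The weights used are real and possibly negative; density and an
affine change of scale reduce them to natural ones (`exists_superset_of_real_weights`). -/

/-! ### Scores of sets and elections as weights. -/

/-- The value of a committee scoring function on a set of positions, `0` if the size is wrong. -/
noncomputable def CommitteeScoringFunction.value {m k : ℕ} (g : CommitteeScoringFunction m k)
    (A : Finset (Fin m)) : ℝ :=
  if h : A.card = k then g.toFun (A.orderEmbOfFin h) else 0

/-- The score of a set of candidates when the order `v` has weight `ω v`. -/
noncomputable def weightedScore {C : Type u} [Fintype C] [DecidableEq C] {k : ℕ}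
    (g : CommitteeScoringFunction (Fintype.card C) k) (ω : PreferenceOrder C → ℝ)
    (T : Finset C) : ℝ :=
  ∑ v, ω v * g.value (T.map v.toEmbedding)

theorem toFun_committeePos {C : Type u} [Fintype C] {k : ℕ}
    (g : CommitteeScoringFunction (Fintype.card C) k) (v : PreferenceOrder C)
    (S : Committee C k) :
    g.toFun (committeePos v S) = g.value (S.1.map v.toEmbedding) := by
  unfold CommitteeScoringFunction.value committeePos
  rw [dif_pos (by rw [Finset.card_map]; exact S.2)]

theorem sum_orderEmbOfFin {m k : ℕ} (γ : Fin m → ℝ) (A : Finset (Fin m)) (h : A.card = k) :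
    ∑ t, γ (A.orderEmbOfFin h t) = ∑ i ∈ A, γ i := by
  conv_rhs => rw [← Finset.map_orderEmbOfFin_univ A h]
  rw [Finset.sum_map]
  rfl

/-- Every weight function with natural values comes from an election. -/
theorem exists_election_score {C : Type u} [Fintype C] [DecidableEq C]
    (n : PreferenceOrder C → ℕ) :
    ∃ E : Election C, ∀ (f : ScoringFamily) (k : ℕ) (S : Committee C k),
      score f E S = weightedScore (f (Fintype.card C) k) (fun v => (n v : ℝ)) S.1 := by
  refine ⟨⟨(∑ v, n v • ({v} : Multiset (PreferenceOrder C))).toList⟩, fun f k S => ?_⟩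
  unfold score weightedScore
  simp only [toFun_committeePos]
  rw [← Multiset.sum_coe, ← Multiset.map_coe, Multiset.coe_toList]
  change Multiset.sum (Multiset.mapAddMonoidHom _ _) = _
  rw [map_sum, ← Multiset.coe_sumAddMonoidHom, map_sum]
  simp [Multiset.map_nsmul, Multiset.sum_nsmul]

/-! ### Exchanges and permutations. -/

/-- Exchanging single elements connects all sets of a given size. -/
theorem eq_of_exchange {α : Type*} [DecidableEq α] (G : Finset α → ℝ) (k : ℕ)
    (hG : ∀ (S : Finset α) (x y : α), S.card + 1 = k → x ∉ S → y ∉ S →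
      G (insert x S) = G (insert y S))
    (A B : Finset α) (hA : A.card = k) (hB : B.card = k) : G A = G B := by
  induction hn : (A \ B).card generalizing A with
  | zero =>
    rw [Finset.card_eq_zero, Finset.sdiff_eq_empty_iff_subset] at hn
    rw [Finset.eq_of_subset_of_card_le hn (by omega)]
  | succ n ih =>
    obtain ⟨a, ha⟩ : (A \ B).Nonempty := by rw [← Finset.card_pos]; omega
    have hBA : (B \ A).card = n + 1 := by
      rw [← hn]; exact Finset.card_sdiff_comm (by omega)
    obtain ⟨b, hb⟩ : (B \ A).Nonempty := by rw [← Finset.card_pos]; omega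
    rw [Finset.mem_sdiff] at ha hb
    have hpos : 0 < A.card := Finset.card_pos.2 ⟨a, ha.1⟩
    have hbe : b ∉ A.erase a := fun h => hb.2 (Finset.mem_of_mem_erase h)
    have hce : (A.erase a).card + 1 = k := by rw [Finset.card_erase_of_mem ha.1]; omega
    have h1 := hG (A.erase a) a b hce (by simp) hbe
    rw [Finset.insert_erase ha.1] at h1
    rw [h1]
    apply ih
    · rw [Finset.card_insert_of_notMem hbe, hce]
    · have : insert b (A.erase a) \ B = (A \ B).erase a := by
        ext z
        simp only [Finset.mem_sdiff, Finset.mem_insert, Finset.mem_erase]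
        constructor
        · rintro ⟨rfl | h, h'⟩
          · exact absurd hb.1 h'
          · exact ⟨h.1, h.2, h'⟩
        · rintro ⟨h, h', h''⟩
          exact ⟨Or.inr ⟨h, h'⟩, h''⟩
      rw [this, Finset.card_erase_of_mem (Finset.mem_sdiff.2 ha)]
      omega

/-- Replacing a position by a better one does not lower the value. -/
theorem value_insert_le {m k : ℕ} (g : CommitteeScoringFunction m k) {S : Finset (Fin m)}
    {x y : Fin m} (hx : x ∉ S) (hy : y ∉ S) (hyx : y ≤ x) :
    g.value (insert x S) ≤ g.value (insert y S) := by
  unfold CommitteeScoringFunction.value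
  have hc : (insert x S).card = (insert y S).card := by
    rw [Finset.card_insert_of_notMem hx, Finset.card_insert_of_notMem hy]
  by_cases h : (insert x S).card = k
  · have h' := hc ▸ h
    rw [dif_pos h, dif_pos h']
    apply g.monotone
    intro t
    by_contra! hlt
    set a := (insert x S).orderEmbOfFin h
    set b := (insert y S).orderEmbOfFin h'
    -- the positions `a 0, …, a t`, with `x` exchanged for `y`, all lie below `b t`
    have hsub : ((Finset.Iic t).image fun s => if a s = x then y else a s) ⊆
        (Finset.Iio t).image b := by
      intro z hz
      obtain ⟨s, hs, rfl⟩ := Finset.mem_image.1 hz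
      have has : a s < b t := lt_of_le_of_lt (a.monotone (Finset.mem_Iic.1 hs)) hlt
      have hmem : a s ∈ insert x S := Finset.orderEmbOfFin_mem _ _ _
      have key : ∀ z, z ∈ insert y S → z < b t → z ∈ (Finset.Iio t).image b := by
        intro z hz hzt
        have : z ∈ Set.range b := by
          rw [Finset.range_orderEmbOfFin]; exact hz
        obtain ⟨r, rfl⟩ := this
        exact Finset.mem_image_of_mem _ (Finset.mem_Iio.2 (b.lt_iff_lt.1 hzt))
      split_ifs with hax
      · exact key y (Finset.mem_insert_self _ _) (lt_of_le_of_lt (hax ▸ hyx) has)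
      · exact key _ (Finset.mem_insert_of_mem ((Finset.mem_insert.1 hmem).resolve_left hax)) has
    have hcard := Finset.card_le_card hsub
    rw [Finset.card_image_of_injective _ b.injective, Finset.card_image_of_injOn] at hcard
    · simp at hcard
    · intro s _ r _ hsr
      have hm : ∀ s, a s ∈ insert x S := fun s => Finset.orderEmbOfFin_mem _ _ _
      have hms : ∀ s, a s ≠ x → a s ∈ S := fun s hs => (Finset.mem_insert.1 (hm s)).resolve_left hs
      dsimp only at hsr
      split_ifs at hsr with h1 h2 h2
      · exact a.injective (h1.trans h2.symm)
      · exact absurd (hms r h2) (hsr ▸ hy)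
      · exact absurd (hms s h1) (hsr ▸ hy)
      · exact a.injective hsr
  · rw [dif_neg h, dif_neg (hc ▸ h)]

/-- Two pairs of a candidate and a set of candidates of the same size are related by a permutation
if the candidates agree on membership. -/
theorem exists_perm_map_eq {C : Type u} [Fintype C] [DecidableEq C] {c c' : C} {T T' : Finset C}
    (hcard : T.card = T'.card) (hc : c ∈ T ↔ c' ∈ T') :
    ∃ π : Equiv.Perm C, π c = c' ∧ T.map π.toEmbedding = T' := by
  obtain ⟨e⟩ : Nonempty ({x // x ∈ T} ≃ {x // x ∈ T'}) := ⟨Finset.equivOfCardEq hcard⟩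
  have h1 : ∀ x, x ∈ T ↔ e.extendSubtype x ∈ T' := fun x =>
    ⟨fun hx => e.extendSubtype_mem x hx, fun hx => by
      by_contra h
      exact e.extendSubtype_not_mem x h hx⟩
  -- The image of `c` and `c'` are both in `T'` or both outside, so swapping them preserves `T'`.
  refine ⟨e.extendSubtype.trans (Equiv.swap (e.extendSubtype c) c'), by simp, ?_⟩
  apply Finset.eq_of_subset_of_card_le
  · intro z hz
    obtain ⟨x, hx, rfl⟩ := Finset.mem_map.1 hz
    have hx' := (h1 x).1 hx
    have hcc := (h1 c).symm.trans hc
    simp only [Equiv.coe_toEmbedding, Equiv.trans_apply]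
    by_cases h2 : e.extendSubtype x = e.extendSubtype c
    · rw [h2, Equiv.swap_apply_left]; exact hcc.1 (h2 ▸ hx')
    · by_cases h3 : e.extendSubtype x = c'
      · rw [h3, Equiv.swap_apply_right]; exact hcc.2 (h3 ▸ hx')
      · rw [Equiv.swap_apply_of_ne_of_ne h2 h3]; exact hx'
  · rw [Finset.card_map, hcard]

/-! ### Weights that depend only on the last candidate. -/

section LastCandidate

variable {C : Type u} [Fintype C] [DecidableEq C] {k : ℕ}

/-- Relabelling candidates by a permutation carries the orders ending in `c` to those ending in
`c'`, so the sum depends only on `T.card` and on whether `c ∈ T`. -/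
theorem sum_last_eq_of_mem_iff (g : CommitteeScoringFunction (Fintype.card C) k)
    (l : Fin (Fintype.card C)) {c c' : C} {T T' : Finset C}
    (hcard : T.card = T'.card) (hc : c ∈ T ↔ c' ∈ T') :
    ∑ v : PreferenceOrder C with v.symm l = c, g.value (T.map v.toEmbedding) =
      ∑ v : PreferenceOrder C with v.symm l = c', g.value (T'.map v.toEmbedding) := by
  obtain ⟨π, rfl, rfl⟩ := exists_perm_map_eq hcard hc
  refine Finset.sum_equiv (Equiv.equivCongr π (Equiv.refl _)) ?_ ?_
  · intro v
    simp [Equiv.equivCongr]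
  · intro v _
    congr 1
    rw [Finset.map_map]
    congr 1
    ext x
    simp [Equiv.equivCongr]

theorem value_insert_last_le (g : CommitteeScoringFunction (Fintype.card C) k)
    {l : Fin (Fintype.card C)} (hl : ∀ i, i ≤ l) {S : Finset C} {y : C}
    (v : PreferenceOrder C) (hS : v.symm l ∉ S) (hy : y ∉ S) :
    g.value ((insert (v.symm l) S).map v.toEmbedding) ≤
      g.value ((insert y S).map v.toEmbedding) := by
  rw [Finset.map_insert, Finset.map_insert]
  apply value_insert_le
  · rw [Finset.mem_map']
    exact hS
  · simpa using hy
  · simpa using hl _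

/-- If the weight of an order depends only on its last candidate, then the scores are additive. -/
theorem exists_weightedScore_last (g : CommitteeScoringFunction (Fintype.card C) k)
    (hk : 1 ≤ k) (hkC : k < Fintype.card C) {l : Fin (Fintype.card C)} (hl : ∀ i, i ≤ l) :
    ∃ a τ : ℝ, 0 ≤ τ ∧
      (∀ (t : C → ℝ) (T : Finset C), T.card = k →
        weightedScore g (fun v => t (v.symm l)) T = a * ∑ c, t c - τ * ∑ c ∈ T, t c) ∧
      (τ = 0 → ∀ (v : PreferenceOrder C) (T T' : Finset C), T.card = k → T'.card = k →
        g.value (T.map v.toEmbedding) = g.value (T'.map v.toEmbedding)) := by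
  set h : C → Finset C → ℝ := fun c T =>
    ∑ v : PreferenceOrder C with v.symm l = c, g.value (T.map v.toEmbedding) with hh
  have hinv : ∀ c c' T T', T.card = T'.card → (c ∈ T ↔ c' ∈ T') → h c T = h c' T' :=
    fun c c' T T' h1 h2 => sum_last_eq_of_mem_iff g l h1 h2
  obtain ⟨U, -, hU⟩ := Finset.exists_subset_card_eq (s := (Finset.univ : Finset C)) (n := k + 1)
    (by rw [Finset.card_univ]; omega)
  obtain ⟨c, hcU⟩ : U.Nonempty := by rw [← Finset.card_pos]; omega
  have hU1 : (U.erase c).card = k := by rw [Finset.card_erase_of_mem hcU]; omega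
  obtain ⟨y, hyU⟩ : (U.erase c).Nonempty := by rw [← Finset.card_pos]; omega
  have hyc : y ≠ c := Finset.ne_of_mem_erase hyU
  set S := (U.erase c).erase y with hSdef
  have hS : S.card + 1 = k := by rw [Finset.card_erase_of_mem hyU]; omega
  have hcS : c ∉ S := by simp [hSdef]
  have hyS : y ∉ S := by simp [hSdef]
  have hdiff : ∀ (c y : C) (S : Finset C), c ∉ S → y ∉ S →
      ∀ v ∈ Finset.univ.filter (fun v : PreferenceOrder C => v.symm l = c),
      g.value ((insert c S).map v.toEmbedding) ≤ g.value ((insert y S).map v.toEmbedding) := by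
    intro c y S hc hy v hv
    obtain rfl := (Finset.mem_filter.1 hv).2
    exact value_insert_last_le g hl v hc hy
  -- By symmetry `h` takes only two values on sets of size `k`; `insert y S` represents `c ∉ T` and
  -- `insert c S` represents `c ∈ T`.
  have hval : ∀ (d : C) (T : Finset C), T.card = k →
      h d T = h c (insert y S) - if d ∈ T then h c (insert y S) - h c (insert c S) else 0 := by
    intro d T hT
    have h1 : (insert y S).card = k := by rw [Finset.card_insert_of_notMem hyS, hS]
    have h2 : (insert c S).card = k := by rw [Finset.card_insert_of_notMem hcS, hS]
    split_ifs with hd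
    · rw [sub_sub_cancel]
      exact hinv _ _ _ _ (by rw [hT, h2]) (by simp [hd])
    · rw [sub_zero]
      exact hinv _ _ _ _ (by rw [hT, h1]) (by simp [hd, hcS, hyc.symm])
  refine ⟨h c (insert y S), h c (insert y S) - h c (insert c S), ?_, ?_, ?_⟩
  · exact sub_nonneg.2 (Finset.sum_le_sum (hdiff c y S hcS hyS))
  · intro t T hT
    have : weightedScore g (fun v => t (v.symm l)) T = ∑ d, t d * h d T := by
      unfold weightedScore
      rw [← Finset.sum_fiberwise Finset.univ (fun v : PreferenceOrder C => v.symm l)]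
      refine Finset.sum_congr rfl fun d _ => ?_
      rw [hh, Finset.mul_sum]
      refine Finset.sum_congr rfl fun v hv => ?_
      dsimp only
      rw [(Finset.mem_filter.1 hv).2]
    rw [this, Finset.sum_congr rfl fun d _ => by rw [hval d T hT]]
    simp only [mul_sub, mul_ite, mul_zero, Finset.sum_sub_distrib, Finset.sum_ite_mem,
      Finset.univ_inter, ← Finset.sum_mul]
    ring
  · intro hτ v T T' hT hT'
    refine eq_of_exchange (fun T => g.value (T.map v.toEmbedding)) k ?_ T T' hT hT'
    -- When `τ = 0`, termwise inequalities have equal sums, so each order is indifferent to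
    -- exchanging its last candidate.
    have hlast : ∀ (S : Finset C) (z : C), S.card + 1 = k → v.symm l ∉ S → z ∉ S →
        g.value ((insert (v.symm l) S).map v.toEmbedding) =
          g.value ((insert z S).map v.toEmbedding) := by
      intro S' z hS' hlS hz
      by_cases hzl : z = v.symm l
      · rw [hzl]
      have hsum : h (v.symm l) (insert (v.symm l) S') = h (v.symm l) (insert z S') := by
        rw [hval (v.symm l) (insert (v.symm l) S')
            (by rw [Finset.card_insert_of_notMem hlS, hS']),
          hval (v.symm l) (insert z S') (by rw [Finset.card_insert_of_notMem hz, hS']), hτ]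
        simp
      exact (Finset.sum_eq_sum_iff_of_le (hdiff _ z S' hlS hz)).1 hsum v (by simp)
    intro S' x z hS' hx hz
    -- Any exchange factors through the last candidate; if that candidate is already in `S'`, the
    -- intermediate set is `S₀` with `x` and `z`.
    by_cases hlS : v.symm l ∈ S'
    · by_cases hxz : x = z
      · rw [hxz]
      set S₀ := S'.erase (v.symm l)
      have hins : insert (v.symm l) S₀ = S' := Finset.insert_erase hlS
      have hl0 : v.symm l ∉ S₀ := by simp [S₀]
      have hx0 : x ∉ S₀ := fun h => hx (Finset.mem_of_mem_erase h)
      have hz0 : z ∉ S₀ := fun h => hz (Finset.mem_of_mem_erase h)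
      have hxl : x ≠ v.symm l := fun h => hx (h ▸ hlS)
      have hzl : z ≠ v.symm l := fun h => hz (h ▸ hlS)
      have hc0 : S₀.card + 1 + 1 = k := by
        rw [← hS', ← hins, Finset.card_insert_of_notMem hl0]
      have e1 := hlast (insert x S₀) z (by rw [Finset.card_insert_of_notMem hx0]; exact hc0)
        (by simp [hl0, hxl.symm]) (by simp [hz0, Ne.symm hxz])
      have e2 := hlast (insert z S₀) x (by rw [Finset.card_insert_of_notMem hz0]; exact hc0)
        (by simp [hl0, hzl.symm]) (by simp [hx0, hxz])
      rw [← hins, Finset.insert_comm x, Finset.insert_comm z]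
      rw [e1, e2, Finset.insert_comm]
    · exact (hlast S' x hS' hlS hx).symm.trans (hlast S' z hS' hlS hz)

end LastCandidate

/-! ### The exchange argument forcing constancy. -/

/-- Among the three ways to add two of `w`, `x`, `y` to `D`, none is strictly best for `s * φ` if
every additive perturbation of `s * φ` has a maximizer above each strict additive optimum of the
next smaller size. -/
theorem not_strict_max_of_forall_exists_superset {C : Type u} [Fintype C] [DecidableEq C] {k : ℕ}
    (φ : Finset C → ℝ) {ρ : ℝ} (hρ : 0 < ρ) (s : ℝ)
    (H : ∀ (t : C → ℝ) (W : Finset C), W.card = k →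
      (∀ T : Finset C, T.card = k → T ≠ W → ∑ c ∈ T, t c < ∑ c ∈ W, t c) →
      ∃ W' : Finset C, W ⊆ W' ∧ W'.card = k + 1 ∧ ∀ T : Finset C, T.card = k + 1 →
        s * φ T + ρ * ∑ c ∈ T, t c ≤ s * φ W' + ρ * ∑ c ∈ W', t c)
    {D : Finset C} {w x y : C} (hD : D.card + 1 = k) (hw : w ∉ D) (hx : x ∉ D) (hy : y ∉ D)
    (hwx : w ≠ x) (hwy : w ≠ y) (hxy : x ≠ y)
    (h1 : s * φ (insert w (insert y D)) < s * φ (insert w (insert x D)))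
    (h2 : s * φ (insert x (insert y D)) < s * φ (insert w (insert x D))) : False := by
  set ψ : Finset C → ℝ := fun A => s * φ A with hψ
  change ψ _ < ψ _ at h1 h2
  set V := insert y D with hV
  set Y := insert w (insert x V) with hY
  set Z := insert w (insert x D) with hZ
  have hVc : V.card = k := by rw [hV, Finset.card_insert_of_notMem hy, hD]
  have hZc : Z.card = k + 1 := by
    rw [hZ, Finset.card_insert_of_notMem (by simp [hw, hwx]), Finset.card_insert_of_notMem hx, hD]
  have hVY : V ⊆ Y := fun z hz => by simp [hY, hz]
  have hZY : Z ⊆ Y := by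
    intro z hz
    simp only [hZ, hY, hV, Finset.mem_insert] at hz ⊢
    tauto
  have hZV : Z ∩ V = D := by
    ext z
    simp only [hZ, hV, Finset.mem_insert, Finset.mem_inter]
    constructor
    · rintro ⟨rfl | rfl | h, h'⟩
      · exact h'.resolve_left hwy
      · exact h'.resolve_left hxy
      · exact h
    · exact fun h => ⟨Or.inr (Or.inr h), Or.inr h⟩
  obtain ⟨M, hM⟩ : ∃ M, ∀ A, |ψ A| ≤ M :=
    ⟨∑ A, |ψ A|, fun A => Finset.single_le_sum (f := fun A => |ψ A|)
      (fun _ _ => abs_nonneg _) (Finset.mem_univ A)⟩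
  have hM0 : 0 ≤ M := (abs_nonneg _).trans (hM ∅)
  -- `δ` is smaller than both gaps. The bonus `ε` on `V` makes `V` the strict optimum of size `k`
  -- and costs `Z`, which misses only `y`, exactly `ρ * ε = δ`. The bonus `N` on `Y` outweighs the
  -- oscillation `2 * M` of `ψ` plus `δ`, so an optimal superset of `V` stays inside `Y`.
  obtain ⟨δ, hδ, hδ1, hδ2⟩ : ∃ δ, 0 < δ ∧ ψ (insert w V) + δ < ψ Z ∧ ψ (insert x V) + δ < ψ Z := by
    refine ⟨min (ψ Z - ψ (insert w V)) (ψ Z - ψ (insert x V)) / 2, ?_, ?_, ?_⟩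
    · have := lt_min (sub_pos.2 h1) (sub_pos.2 h2)
      linarith
    · have := min_le_left (ψ Z - ψ (insert w V)) (ψ Z - ψ (insert x V))
      linarith
    · have := min_le_right (ψ Z - ψ (insert w V)) (ψ Z - ψ (insert x V))
      linarith
  set N : ℝ := (2 * M + 1 + δ) / ρ with hN
  set ε : ℝ := δ / ρ with hε
  have hρN : ρ * N = 2 * M + 1 + δ := by rw [hN]; field_simp
  have hρε : ρ * ε = δ := by rw [hε]; field_simp
  have hN0 : 0 ≤ N := by positivity
  have hε0 : 0 < ε := by positivity
  have hsum : ∀ T : Finset C, ∑ c ∈ T, ((if c ∈ Y then N else 0) + if c ∈ V then ε else 0) =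
      (T ∩ Y).card * N + (T ∩ V).card * ε := by
    intro T
    rw [Finset.sum_add_distrib, Finset.sum_ite_mem, Finset.sum_ite_mem]
    simp
  obtain ⟨W', hVW, hWc, hmax⟩ := H (fun c => (if c ∈ Y then N else 0) + if c ∈ V then ε else 0) V
    hVc (by
      intro T hT hTV
      rw [hsum, hsum, Finset.inter_eq_left.2 hVY, Finset.inter_self, hVc]
      have a1 : ((T ∩ Y).card : ℝ) ≤ k := by
        exact_mod_cast hT ▸ Finset.card_le_card Finset.inter_subset_left
      have a2 : ((T ∩ V).card : ℝ) < k := by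
        have : T ∩ V ⊂ V := by
          refine Finset.ssubset_iff_subset_ne.2 ⟨Finset.inter_subset_right, fun h => hTV ?_⟩
          exact (Finset.eq_of_subset_of_card_le (Finset.inter_eq_right.1 h)
            (by rw [hT, hVc])).symm
        exact_mod_cast hVc ▸ Finset.card_lt_card this
      exact add_lt_add_of_le_of_lt (mul_le_mul_of_nonneg_right a1 hN0)
        (mul_lt_mul_of_pos_right a2 hε0))
  have hle := hmax Z hZc
  rw [hsum, hsum, Finset.inter_eq_left.2 hZY, hZV, Finset.inter_eq_right.2 hVW, hZc, hVc] at hle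
  have hDk : (D.card : ℝ) + 1 = k := by exact_mod_cast hD
  obtain ⟨z, hz, rfl⟩ : ∃ z ∉ V, insert z V = W' :=
    Finset.exists_eq_insert_iff.2 ⟨hVW, by rw [hVc, hWc]⟩
  change ψ Z + _ ≤ ψ (insert z V) + _ at hle
  by_cases hzY : z ∈ Y
  · have hc : (insert z V ∩ Y).card = k + 1 := by
      rw [Finset.inter_eq_left.2 (Finset.insert_subset hzY hVY), hWc]
    rw [hc] at hle
    have hzz : ψ (insert z V) + δ < ψ Z := by
      rcases Finset.mem_insert.1 hzY with rfl | hzY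
      · exact hδ1
      rcases Finset.mem_insert.1 hzY with rfl | hzY
      · exact hδ2
      · exact absurd hzY hz
    rw [← hDk] at hle
    nlinarith
  · have hc : (insert z V ∩ Y).card = k := by
      rw [Finset.insert_inter_of_notMem hzY, Finset.inter_eq_left.2 hVY, hVc]
    rw [hc] at hle
    push_cast at hle
    rw [← hDk] at hle
    have b1 := abs_le.1 (hM Z)
    have b2 := abs_le.1 (hM (insert z V))
    nlinarith

/-- A set function that, after any additive perturbation, has a maximizer above the strict
additive optimum of the next smaller size, is constant. -/
theorem eq_of_forall_exists_superset {C : Type u} [Fintype C] [DecidableEq C] {k : ℕ}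
    (hk : 1 ≤ k) (φ : Finset C → ℝ) {ρ : ℝ} (hρ : 0 < ρ)
    (H : ∀ (s : ℝ) (t : C → ℝ) (W : Finset C), W.card = k →
      (∀ T : Finset C, T.card = k → T ≠ W → ∑ c ∈ T, t c < ∑ c ∈ W, t c) →
      ∃ W' : Finset C, W ⊆ W' ∧ W'.card = k + 1 ∧ ∀ T : Finset C, T.card = k + 1 →
        s * φ T + ρ * ∑ c ∈ T, t c ≤ s * φ W' + ρ * ∑ c ∈ W', t c)
    (A B : Finset C) (hA : A.card = k + 1) (hB : B.card = k + 1) : φ A = φ B := by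
  refine eq_of_exchange φ (k + 1) ?_ A B hA hB
  intro S x y hS hx hy
  by_cases hxy : x = y
  · rw [hxy]
  obtain ⟨w, hwS⟩ : S.Nonempty := by rw [← Finset.card_pos]; omega
  have hins : insert w (S.erase w) = S := Finset.insert_erase hwS
  set D := S.erase w
  have hw : w ∉ D := Finset.notMem_erase w S
  have hxD : x ∉ D := fun h => hx (Finset.mem_of_mem_erase h)
  have hyD : y ∉ D := fun h => hy (Finset.mem_of_mem_erase h)
  have hwx : w ≠ x := fun h => hx (h ▸ hwS)
  have hwy : w ≠ y := fun h => hy (h ▸ hwS)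
  have hD : D.card + 1 = k := by
    rw [← hins, Finset.card_insert_of_notMem hw] at hS
    omega
  rw [← hins, Finset.insert_comm x, Finset.insert_comm y]
  have key : ∀ s : ℝ, ∀ {w x y : C}, w ∉ D → x ∉ D → y ∉ D → w ≠ x → w ≠ y → x ≠ y →
      s * φ (insert w (insert y D)) < s * φ (insert w (insert x D)) →
      s * φ (insert x (insert y D)) < s * φ (insert w (insert x D)) → False :=
    fun s _ _ _ hw hx hy hwx hwy hxy h1 h2 =>
      not_strict_max_of_forall_exists_superset φ hρ s (H s) hD hw hx hy hwx hwy hxy h1 h2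
  -- If the two values differ, then among the three pairs either the larger is a strict maximum or
  -- the smaller is a strict minimum; the latter is handled by `s = -1`.
  have step : ∀ {x y : C}, x ∉ D → y ∉ D → w ≠ x → w ≠ y → x ≠ y →
      φ (insert w (insert x D)) < φ (insert w (insert y D)) → False := by
    intro x y hx hy hwx hwy hxy hlt
    rcases lt_or_ge (φ (insert y (insert x D))) (φ (insert w (insert y D))) with h | h
    · exact key 1 hw hy hx hwy hwx hxy.symm (by linarith) (by linarith)
    · refine key (-1) hw hx hy hwx hwy hxy (by linarith) ?_
      rw [Finset.insert_comm x y]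
      linarith
  rcases lt_trichotomy (φ (insert w (insert x D))) (φ (insert w (insert y D))) with h | h | h
  · exact (step hxD hyD hwx hwy hxy h).elim
  · exact h
  · exact (step hyD hxD hwy hwx (Ne.symm hxy) h).elim

/-! ### From natural weights to real weights. -/

section Weights

variable {C : Type u} [Fintype C] [DecidableEq C] {k : ℕ}

theorem weightedScore_smul_add (g : CommitteeScoringFunction (Fintype.card C) k) (r s : ℝ)
    (ω ω' : PreferenceOrder C → ℝ) (T : Finset C) :
    weightedScore g (fun v => r * ω v + s * ω' v) T =
      r * weightedScore g ω T + s * weightedScore g ω' T := by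
  simp only [weightedScore, Finset.mul_sum, ← Finset.sum_add_distrib]
  exact Finset.sum_congr rfl fun v _ => by ring

theorem weightedScore_single (g : CommitteeScoringFunction (Fintype.card C) k)
    (v : PreferenceOrder C) (T : Finset C) :
    weightedScore g (fun v' => if v' = v then 1 else 0) T = g.value (T.map v.toEmbedding) := by
  simp [weightedScore]

theorem continuous_weightedScore (g : CommitteeScoringFunction (Fintype.card C) k)
    (T : Finset C) : Continuous fun ω => weightedScore g ω T := by
  unfold weightedScore
  fun_prop

/-- Shifting all weights by a constant therefore does not affect comparisons, which is what admits
negative weights. -/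
theorem weightedScore_one_eq (g : CommitteeScoringFunction (Fintype.card C) k)
    (hk : 1 ≤ k) (hkC : k < Fintype.card C) {T T' : Finset C} (hT : T.card = k)
    (hT' : T'.card = k) :
    weightedScore g (fun _ => 1) T = weightedScore g (fun _ => 1) T' := by
  obtain ⟨a, τ, -, h, -⟩ := exists_weightedScore_last g hk hkC
    (l := ⟨Fintype.card C - 1, by omega⟩) (fun i => Fin.le_def.2 (by have := i.2; simp; omega))
  have h1 := h (fun _ => 1) T hT
  have h2 := h (fun _ => 1) T' hT'
  simp only [Finset.sum_const, hT, hT'] at h1 h2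
  rw [h1, h2]

variable {f : ScoringFamily}

theorem exists_superset_of_nat_weights
    (hf : IsCommitteeEnlargementMonotone.{u} (committeeScoringRule.{u} f))
    (hk : 1 ≤ k) (hkC : k < Fintype.card C) (n : PreferenceOrder C → ℕ) (W : Finset C)
    (hW : W.card = k)
    (hmax : ∀ T : Finset C, T.card = k → weightedScore (f (Fintype.card C) k) (fun v => n v) T ≤
      weightedScore (f (Fintype.card C) k) (fun v => n v) W) :
    ∃ W' : Finset C, W ⊆ W' ∧ W'.card = k + 1 ∧ ∀ T : Finset C, T.card = k + 1 →
      weightedScore (f (Fintype.card C) (k + 1)) (fun v => n v) T ≤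
        weightedScore (f (Fintype.card C) (k + 1)) (fun v => n v) W' := by
  obtain ⟨E, hE⟩ := exists_election_score n
  obtain ⟨W', hW', hsub⟩ := (hf C E k hk hkC).1 ⟨W, hW⟩ (fun T => by
    rw [hE, hE]; exact hmax T.1 T.2)
  refine ⟨W'.1, hsub, W'.2, fun T hT => ?_⟩
  have := hW' ⟨T, hT⟩
  rwa [hE, hE] at this

theorem exists_subset_of_nat_weights
    (hf : IsCommitteeEnlargementMonotone.{u} (committeeScoringRule.{u} f))
    (hk : 1 ≤ k) (hkC : k < Fintype.card C) (n : PreferenceOrder C → ℕ) (W : Finset C)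
    (hW : W.card = k + 1)
    (hmax : ∀ T : Finset C, T.card = k + 1 →
      weightedScore (f (Fintype.card C) (k + 1)) (fun v => n v) T ≤
        weightedScore (f (Fintype.card C) (k + 1)) (fun v => n v) W) :
    ∃ W' : Finset C, W' ⊆ W ∧ W'.card = k ∧ ∀ T : Finset C, T.card = k →
      weightedScore (f (Fintype.card C) k) (fun v => n v) T ≤
        weightedScore (f (Fintype.card C) k) (fun v => n v) W' := by
  obtain ⟨E, hE⟩ := exists_election_score n
  obtain ⟨W', hW', hsub⟩ := (hf C E k hk hkC).2 ⟨W, hW⟩ (fun T => by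
    rw [hE, hE]; exact hmax T.1 T.2)
  refine ⟨W'.1, hsub, W'.2, fun T hT => ?_⟩
  have := hW' ⟨T, hT⟩
  rwa [hE, hE] at this

/-- Every nonempty open set of real weights contains one that arises from natural weights by an
affine change of scale. -/
theorem exists_nat_weights_mem_of_isOpen {ι : Type*} [Fintype ι] {U : Set (ι → ℝ)} (hU : IsOpen U)
    (hne : U.Nonempty) :
    ∃ (n : ι → ℕ) (r s : ℝ), 0 < r ∧ ∃ ω ∈ U, ∀ i, (n i : ℝ) = r * ω i + s * 1 := by
  obtain ⟨q, hq⟩ := (DenseRange.piMap fun _ : ι => Rat.denseRange_cast (𝕜 := ℝ)).exists_mem_open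
    hU hne
  set N : ℕ := ∏ i, (q i).den with hN
  have hNpos : 0 < N := Finset.prod_pos fun i _ => (q i).den_pos
  have hz : ∀ i, ∃ z : ℤ, (z : ℝ) = N * (q i : ℝ) := by
    intro i
    obtain ⟨d, hd⟩ := Finset.dvd_prod_of_mem (fun i => (q i).den) (Finset.mem_univ i)
    refine ⟨d * (q i).num, ?_⟩
    have h0 : ((q i).den : ℝ) ≠ 0 := by exact_mod_cast (q i).den_nz
    rw [hN, hd, Rat.cast_def (q i)]
    push_cast
    field_simp
  choose z hz using hz
  -- Rational weights are scaled by the product of their denominators, then shifted by `∑ j, |z j|`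
  -- to become nonnegative.
  refine ⟨fun i => (z i + ∑ j, |z j|).toNat, N, (∑ j, |z j| : ℤ), by exact_mod_cast hNpos,
    _, hq, fun i => ?_⟩
  have h1 : 0 ≤ z i + ∑ j, |z j| := by
    have h2 := Finset.single_le_sum (f := fun j => |z j|) (fun _ _ => abs_nonneg _)
      (Finset.mem_univ i)
    have h3 := neg_abs_le (z i)
    omega
  have h4 : (((z i + ∑ j, |z j|).toNat : ℤ) : ℝ) = (z i + ∑ j, |z j| : ℤ) := by
    rw [Int.toNat_of_nonneg h1]
  rw [Int.cast_natCast] at h4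
  rw [h4, Int.cast_add, hz]
  simp [Pi.map]

/-- A failure consists of finitely many strict inequalities, hence persists on an open set of
weights, where an affine rescaling of natural weights contradicts monotonicity. This is why `W` must
be a strict optimum. -/
theorem exists_superset_of_real_weights
    (hf : IsCommitteeEnlargementMonotone.{u} (committeeScoringRule.{u} f))
    (hk : 1 ≤ k) (hkC : k + 1 < Fintype.card C) (ω : PreferenceOrder C → ℝ) (W : Finset C)
    (hW : W.card = k)
    (hmax : ∀ T : Finset C, T.card = k → T ≠ W → weightedScore (f (Fintype.card C) k) ω T <
      weightedScore (f (Fintype.card C) k) ω W) :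
    ∃ W' : Finset C, W ⊆ W' ∧ W'.card = k + 1 ∧ ∀ T : Finset C, T.card = k + 1 →
      weightedScore (f (Fintype.card C) (k + 1)) ω T ≤
        weightedScore (f (Fintype.card C) (k + 1)) ω W' := by
  by_contra! hno
  choose! B hB hlt using hno
  have hopen : IsOpen {ω | (∀ T : Finset C, T.card = k → T ≠ W →
      weightedScore (f (Fintype.card C) k) ω T < weightedScore (f (Fintype.card C) k) ω W) ∧
      ∀ W' : Finset C, W ⊆ W' → W'.card = k + 1 →
        weightedScore (f (Fintype.card C) (k + 1)) ω W' <
          weightedScore (f (Fintype.card C) (k + 1)) ω (B W')} := by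
    simp only [Set.ofPred_and, Set.ofPred_forall]
    refine IsOpen.inter ?_ ?_
    · exact isOpen_iInter_of_finite fun T => isOpen_iInter_of_finite fun _ =>
        isOpen_iInter_of_finite fun _ =>
          isOpen_lt (continuous_weightedScore _ _) (continuous_weightedScore _ _)
    · exact isOpen_iInter_of_finite fun T => isOpen_iInter_of_finite fun _ =>
        isOpen_iInter_of_finite fun _ =>
          isOpen_lt (continuous_weightedScore _ _) (continuous_weightedScore _ _)
  obtain ⟨n, r, s, hr, ω', ⟨h1, h2⟩, hn⟩ := exists_nat_weights_mem_of_isOpen hopen ⟨ω, hmax, hlt⟩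
  have hscore : ∀ (j : ℕ) (T : Finset C), weightedScore (f (Fintype.card C) j) (fun v => n v) T =
      r * weightedScore (f (Fintype.card C) j) ω' T +
        s * weightedScore (f (Fintype.card C) j) (fun _ => 1) T := by
    intro j T
    rw [← weightedScore_smul_add]
    simp only [hn]
  obtain ⟨W', hsub, hc, hW'⟩ := exists_superset_of_nat_weights hf hk (by omega) n W hW (by
    intro T hT
    by_cases hTW : T = W
    · rw [hTW]
    rw [hscore, hscore, weightedScore_one_eq _ hk (by omega) hT hW]
    have := mul_lt_mul_of_pos_left (h1 T hT hTW) hr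
    linarith)
  have h3 := hW' (B W') (hB W' hsub hc)
  rw [hscore, hscore, weightedScore_one_eq _ (by omega) hkC (hB W' hsub hc) hc] at h3
  have := mul_lt_mul_of_pos_left (h2 W' hsub hc) hr
  linarith

end Weights

/-! ### Induction on the committee size. -/

/-- The scores of single positions. -/
noncomputable def ScoringFamily.positionScore (f : ScoringFamily) (m : ℕ) :
    SingleWinnerScoringFunction m where
  toFun i := (f m 1).value {i}
  nonneg i := by
    unfold CommitteeScoringFunction.value
    split_ifs
    · exact (f m 1).nonneg _
    · exact le_rfl
  nonincreasing i j hij := value_insert_le (f m 1) (S := ∅) (by simp) (by simp) hij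

/-- The additive scoring functions with the scores of single positions. -/
noncomputable def ScoringFamily.additive (f : ScoringFamily) : ScoringFamily := fun m _ =>
  { toFun := fun I => ∑ t, (f.positionScore m).toFun (I t)
    nonneg := fun _ => Finset.sum_nonneg fun _ _ => (f.positionScore m).nonneg _
    monotone := fun _ _ h => Finset.sum_le_sum fun t _ =>
      (f.positionScore m).nonincreasing _ _ (h t) }

theorem value_eq_affine_succ {C : Type u} [Fintype C] [DecidableEq C] {k : ℕ} {f : ScoringFamily}
    (hf : IsCommitteeEnlargementMonotone.{u} (committeeScoringRule.{u} f))
    (γ : Fin (Fintype.card C) → ℝ) (hk : 1 ≤ k) (hkC : k + 1 < Fintype.card C)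
    (h : ∃ α β : ℝ, 0 < α ∧ ∀ A : Finset (Fin (Fintype.card C)), A.card = k →
      (f (Fintype.card C) k).value A = α * ∑ i ∈ A, γ i + β) :
    ∃ α β : ℝ, 0 < α ∧ ∀ A : Finset (Fin (Fintype.card C)), A.card = k + 1 →
      (f (Fintype.card C) (k + 1)).value A = α * ∑ i ∈ A, γ i + β := by
  obtain ⟨α, β, hα, h⟩ := h
  obtain ⟨l, hl⟩ : ∃ l : Fin (Fintype.card C), ∀ i, i ≤ l :=
    ⟨⟨Fintype.card C - 1, by omega⟩, fun i => Fin.le_def.2 (by have := i.2; simp; omega)⟩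
  obtain ⟨a, τ, hτ, hs, hcon⟩ := exists_weightedScore_last (f (Fintype.card C) k) hk
    (by omega) hl
  obtain ⟨a', τ', hτ', hs', hcon'⟩ := exists_weightedScore_last (f (Fintype.card C) (k + 1))
    (by omega) hkC hl
  set v₀ : PreferenceOrder C := Fintype.equivFin C
  have hmap : ∀ A : Finset (Fin (Fintype.card C)),
      (A.map v₀.symm.toEmbedding).map v₀.toEmbedding = A := by
    intro A
    rw [Finset.map_map]
    ext i
    simp
  obtain ⟨U, -, hU⟩ := Finset.exists_subset_card_eq (s := (Finset.univ : Finset C)) (n := k + 2)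
    (by rw [Finset.card_univ]; omega)
  obtain ⟨c, hcU⟩ : U.Nonempty := by rw [← Finset.card_pos]; omega
  have hU1 : (U.erase c).card = k + 1 := by rw [Finset.card_erase_of_mem hcU]; omega
  have hsn : ∀ (t : C → ℕ) (T : Finset C), T.card = k →
      weightedScore (f (Fintype.card C) k) (fun v => (t (v.symm l) : ℝ)) T =
        a * ∑ c, (t c : ℝ) - τ * ∑ c ∈ T, (t c : ℝ) := fun t => hs fun c => t c
  have hsn' : ∀ (t : C → ℕ) (T : Finset C), T.card = k + 1 →
      weightedScore (f (Fintype.card C) (k + 1)) (fun v => (t (v.symm l) : ℝ)) T =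
        a' * ∑ c, (t c : ℝ) - τ' * ∑ c ∈ T, (t c : ℝ) := fun t => hs' fun c => t c
  rcases hτ.eq_or_lt with hτ0 | hτ0
  · have hτ'0 : τ' = 0 := by
      by_contra hne
      have hpos : 0 < τ' := lt_of_le_of_ne hτ' (Ne.symm hne)
      obtain ⟨W, hW, -, hWk⟩ := Finset.exists_subsuperset_card_eq (n := k)
        (Finset.subset_univ {c}) (by simpa using hk) (by rw [Finset.card_univ]; omega)
      -- All committees of size `k` tie, so `W` containing `c` wins; yet every superset of `W` pays
      -- the penalty `τ'` that `U.erase c` avoids.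
      set t : C → ℕ := fun d => if d = c then 1 else 0 with ht
      obtain ⟨W', hsub, hc', hmax⟩ := exists_superset_of_nat_weights hf hk (by omega)
        (fun v : PreferenceOrder C => t (v.symm l)) W hWk (by
          intro T hT
          rw [hsn t T hT, hsn t W hWk, ← hτ0]
          simp)
      have h1 := hmax _ hU1
      rw [hsn' t _ hU1, hsn' t W' hc'] at h1
      have hcW' : c ∈ W' := hsub (hW (Finset.mem_singleton_self c))
      have h2 : ∑ d ∈ W', (t d : ℝ) = 1 := by simp [ht, hcW']
      have h3 : ∑ d ∈ U.erase c, (t d : ℝ) = 0 := by simp [ht]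
      rw [h2, h3] at h1
      linarith
    -- The affine form of a constant function, compared on `V.erase i` and `V.erase j`, makes `γ`
    -- constant; any positive `α` then serves at size `k + 1`.
    have hγ : ∀ i j, γ i = γ j := by
      intro i j
      by_cases hij : i = j
      · rw [hij]
      obtain ⟨V, hV, -, hVk⟩ := Finset.exists_subsuperset_card_eq (n := k + 1)
        (Finset.subset_univ {i, j}) (by rw [Finset.card_pair hij]; omega)
        (by rw [Finset.card_univ, Fintype.card_fin]; omega)
      have hi : i ∈ V := hV (by simp)
      have hj : j ∈ V := hV (by simp)
      have hci : (V.erase i).card = k := by rw [Finset.card_erase_of_mem hi]; omega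
      have hcj : (V.erase j).card = k := by rw [Finset.card_erase_of_mem hj]; omega
      have h1 := hcon hτ0.symm v₀ ((V.erase i).map v₀.symm.toEmbedding)
        ((V.erase j).map v₀.symm.toEmbedding) (by rw [Finset.card_map, hci])
        (by rw [Finset.card_map, hcj])
      rw [hmap, hmap, h _ hci, h _ hcj, add_left_inj, mul_right_inj' hα.ne'] at h1
      have h2 := Finset.add_sum_erase V γ hi
      have h3 := Finset.add_sum_erase V γ hj
      linarith
    have hconst : ∀ A : Finset (Fin (Fintype.card C)), ∑ i ∈ A, γ i = A.card * γ l := by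
      intro A
      rw [Finset.sum_congr rfl fun i _ => hγ i l]
      simp
    refine ⟨1, (f (Fintype.card C) (k + 1)).value ((U.erase c).map v₀.toEmbedding) -
      (k + 1 : ℕ) * γ l, one_pos, fun A hA => ?_⟩
    have h1 := hcon' hτ'0 v₀ (A.map v₀.symm.toEmbedding) (U.erase c) (by simpa using hA) hU1
    rw [hmap] at h1
    rw [h1, hconst, hA]
    ring
  · have hτ'pos : 0 < τ' := by
      refine lt_of_le_of_ne hτ' fun hτ'0 => ?_
      -- all committees of size `k + 1` tie, while a single one of size `k` can win
      obtain ⟨W₀, hW₀, -, hW₀k⟩ := Finset.exists_subsuperset_card_eq (n := k)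
        (Finset.subset_univ {c}) (by simpa using hk) (by rw [Finset.card_univ]; omega)
      set t : C → ℕ := fun d => if d ∈ W₀ then 0 else 1 with ht
      obtain ⟨W', hsub, hc', hmax⟩ := exists_subset_of_nat_weights hf hk (by omega)
        (fun v : PreferenceOrder C => t (v.symm l)) (U.erase c) hU1 (by
          intro T hT
          rw [hsn' t T hT, hsn' t _ hU1, ← hτ'0]
          simp)
      have h1 := hmax W₀ hW₀k
      have h2 : ∑ d ∈ W₀, (t d : ℝ) = 0 := Finset.sum_eq_zero fun d hd => by simp [ht, hd]
      rw [hsn t _ hW₀k, hsn t W' hc', h2] at h1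
      have h3 : 0 < ∑ d ∈ W', (t d : ℝ) := by
        have hne : ¬ W' ⊆ W₀ := fun hss => by
          have := Finset.eq_of_subset_of_card_le hss (by omega)
          exact Finset.notMem_erase c U (hsub (this ▸ hW₀ (Finset.mem_singleton_self c)))
        obtain ⟨d, hd, hd'⟩ := Finset.not_subset.1 hne
        exact Finset.sum_pos' (fun _ _ => Nat.cast_nonneg _) ⟨d, hd, by simp [ht, hd']⟩
      have := mul_pos hτ0 h3
      linarith
    set ρ := τ' / τ with hρ
    have hρpos : 0 < ρ := div_pos hτ'pos hτ0
    have key := eq_of_forall_exists_superset hk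
      (fun T => (f (Fintype.card C) (k + 1)).value (T.map v₀.toEmbedding) -
        ρ * α * ∑ c ∈ T, γ (v₀ c)) hρpos (by
      intro s t W hW hlt
      -- At size `k`, the weights `(s * α * γ - t) / τ` enter with factor `-τ`, cancelling `s * α *
      -- ∑ γ` and leaving `∑ t`. At size `k + 1` the factor is `-τ'`, whence `ρ = τ' / τ`.
      have hdec : ∀ (j : ℕ) (T : Finset C), weightedScore (f (Fintype.card C) j) (fun v =>
          s * (if v = v₀ then 1 else 0) + 1 * ((s * α * γ (v₀ (v.symm l)) - t (v.symm l)) / τ)) T =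
          s * (f (Fintype.card C) j).value (T.map v₀.toEmbedding) +
            1 * weightedScore (f (Fintype.card C) j)
              (fun v => (s * α * γ (v₀ (v.symm l)) - t (v.symm l)) / τ) T := by
        intro j T
        rw [weightedScore_smul_add, weightedScore_single]
      set b : ℝ := ∑ c, (s * α * γ (v₀ c) - t c) / τ with hb
      have hsplit : ∀ T : Finset C, ∑ c ∈ T, (s * α * γ (v₀ c) - t c) / τ =
          (s * α * ∑ c ∈ T, γ (v₀ c) - ∑ c ∈ T, t c) / τ := by
        intro T
        rw [← Finset.sum_div, Finset.sum_sub_distrib, ← Finset.mul_sum]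
      have hk1 : ∀ T : Finset C, T.card = k → weightedScore (f (Fintype.card C) k) (fun v =>
          s * (if v = v₀ then 1 else 0) + 1 * ((s * α * γ (v₀ (v.symm l)) - t (v.symm l)) / τ)) T =
          s * β + a * b + ∑ c ∈ T, t c := by
        intro T hT
        rw [hdec, hs (fun c => (s * α * γ (v₀ c) - t c) / τ) T hT, h _ (by simpa using hT),
          Finset.sum_map, ← hb, hsplit]
        simp only [Equiv.coe_toEmbedding]
        field_simp
        ring
      have hk2 : ∀ T : Finset C, T.card = k + 1 →
          weightedScore (f (Fintype.card C) (k + 1)) (fun v =>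
          s * (if v = v₀ then 1 else 0) + 1 * ((s * α * γ (v₀ (v.symm l)) - t (v.symm l)) / τ)) T =
          a' * b + (s * ((f (Fintype.card C) (k + 1)).value (T.map v₀.toEmbedding) -
            ρ * α * ∑ c ∈ T, γ (v₀ c)) + ρ * ∑ c ∈ T, t c) := by
        intro T hT
        rw [hdec, hs' (fun c => (s * α * γ (v₀ c) - t c) / τ) T hT, ← hb, hsplit, hρ]
        field_simp
        ring
      obtain ⟨W', hsub, hc', hmax⟩ := exists_superset_of_real_weights hf hk hkC _ W hW (by
        intro T hT hTW
        rw [hk1 T hT, hk1 W hW]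
        linarith [hlt T hT hTW])
      refine ⟨W', hsub, hc', fun T hT => ?_⟩
      have h1 := hmax T hT
      rw [hk2 T hT, hk2 W' hc'] at h1
      linarith)
    refine ⟨ρ * α, (f (Fintype.card C) (k + 1)).value ((U.erase c).map v₀.toEmbedding) -
        ρ * α * ∑ c ∈ U.erase c, γ (v₀ c), mul_pos hρpos hα, fun A hA => ?_⟩
    have h1 := key (A.map v₀.symm.toEmbedding) (U.erase c) (by simpa using hA) hU1
    rw [hmap, Finset.sum_map] at h1
    simp only [Equiv.coe_toEmbedding, Equiv.apply_symm_apply] at h1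
    linarith

theorem value_eq_affine {C : Type u} [Fintype C] [DecidableEq C] {f : ScoringFamily}
    (hf : IsCommitteeEnlargementMonotone.{u} (committeeScoringRule.{u} f))
    {k : ℕ} (hk : 1 ≤ k) (hkC : k < Fintype.card C) :
    ∃ α β : ℝ, 0 < α ∧ ∀ A : Finset (Fin (Fintype.card C)), A.card = k →
      (f (Fintype.card C) k).value A =
        α * ∑ i ∈ A, (f.positionScore (Fintype.card C)).toFun i + β := by
  induction k, hk using Nat.le_induction with
  | base =>
    refine ⟨1, 0, one_pos, fun A hA => ?_⟩
    obtain ⟨i, rfl⟩ := Finset.card_eq_one.1 hA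
    simp [ScoringFamily.positionScore]
  | succ k hk ih => exact value_eq_affine_succ hf _ hk hkC (ih (by omega))

theorem isSeparableRule_of_isCommitteeEnlargementMonotone {f : ScoringFamily}
    (hf : IsCommitteeEnlargementMonotone.{u} (committeeScoringRule.{u} f)) :
    IsSeparableRule.{u} (committeeScoringRule.{u} f) := by
  classical
  refine ⟨f.additive, ⟨f.positionScore, fun _ _ _ _ _ => rfl⟩, ?_⟩
  funext C _ E k hk hkC
  ext S
  change (∀ T, score f E T ≤ score f E S) ↔ ∀ T, score f.additive E T ≤ score f.additive E S
  rcases hkC.eq_or_lt with rfl | hlt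
  -- The full committee is the only one of size `m`, so no affine formula is needed here.
  · have : ∀ T, T = S := fun T => Subtype.ext (by
      rw [(Finset.card_eq_iff_eq_univ _).1 T.2, (Finset.card_eq_iff_eq_univ _).1 S.2])
    exact ⟨fun _ T => by rw [this T], fun _ T => by rw [this T]⟩
  · obtain ⟨α, β, hα, h⟩ := value_eq_affine hf hk hlt
    have hscore : ∀ T : Committee C k,
        score f E T = α * score f.additive E T + E.voters.length * β := by
      intro T
      unfold score
      rw [← List.sum_map_mul_left]
      induction E.voters with
      | nil => simp
      | cons v L ih =>
        simp only [List.map_cons, List.sum_cons, ih, List.length_cons]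
        rw [toFun_committeePos, h _ (by rw [Finset.card_map]; exact T.2)]
        simp only [ScoringFamily.additive, committeePos, sum_orderEmbOfFin]
        push_cast
        ring
    simp only [hscore, add_le_add_iff_right, mul_le_mul_iff_right₀ hα]

/-! ### Separable rules are monotone. -/

theorem isCommitteeEnlargementMonotone_of_isSeparable {g : ScoringFamily} (hg : g.IsSeparable) :
    IsCommitteeEnlargementMonotone.{u} (committeeScoringRule.{u} g) := by
  classical
  obtain ⟨γ, hγ⟩ := hg
  intro C _ E k hk hkC
  set s : C → ℝ := fun c => (E.voters.map fun v => (γ (Fintype.card C)).toFun (v c)).sum with hs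
  have hscore : ∀ j : ℕ, 1 ≤ j → j ≤ Fintype.card C → ∀ T : Committee C j,
      score g E T = ∑ c ∈ T.1, s c := by
    intro j hj hjC T
    unfold score
    simp only [hs, hγ _ j hj hjC, committeePos, sum_orderEmbOfFin, Finset.sum_map,
      Equiv.coe_toEmbedding]
    induction E.voters with
    | nil => simp
    | cons v L ih => simp only [List.map_cons, List.sum_cons, ih, Finset.sum_add_distrib]
  constructor
  · intro W hW
    obtain ⟨x, hx, hxmax⟩ := Finset.exists_max_image W.1ᶜ s (by
      rw [← Finset.card_pos, Finset.card_compl, W.2]; omega)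
    rw [Finset.mem_compl] at hx
    refine ⟨⟨insert x W.1, by rw [Finset.card_insert_of_notMem hx, W.2]⟩, fun T => ?_,
      Finset.subset_insert _ _⟩
    rw [hscore _ (by omega) hkC, hscore _ (by omega) hkC, Finset.sum_insert hx]
    -- A competitor `T` has a member `z` outside `W`: `z` scores at most `x`, and the rest of `T`
    -- scores at most `W`.
    obtain ⟨z, hzT, hzW⟩ := Finset.exists_mem_notMem_of_card_lt_card
      (s := W.1) (t := T.1) (by rw [W.2, T.2]; omega)
    have h1 := hW ⟨T.1.erase z, by rw [Finset.card_erase_of_mem hzT, T.2]; rfl⟩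
    rw [hscore _ hk hkC.le, hscore _ hk hkC.le] at h1
    have h2 := hxmax z (Finset.mem_compl.2 hzW)
    rw [← Finset.add_sum_erase _ _ hzT]
    exact add_le_add h2 h1
  · intro W hW
    obtain ⟨x, hx, hxmin⟩ := Finset.exists_min_image W.1 s (by
      rw [← Finset.card_pos, W.2]; omega)
    refine ⟨⟨W.1.erase x, by rw [Finset.card_erase_of_mem hx, W.2]; rfl⟩, fun T => ?_,
      Finset.erase_subset _ _⟩
    rw [hscore _ hk hkC.le, hscore _ hk hkC.le]
    -- Adding to `T` a member `z` of `W` gives a competitor of `W`, and `z` scores at least the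
    -- removed `x`.
    obtain ⟨z, hzW, hzT⟩ := Finset.exists_mem_notMem_of_card_lt_card
      (s := T.1) (t := W.1) (by rw [W.2, T.2]; omega)
    have h1 := hW ⟨insert z T.1, by rw [Finset.card_insert_of_notMem hzT, T.2]⟩
    rw [hscore _ (by omega) hkC, hscore _ (by omega) hkC] at h1
    dsimp only at h1 ⊢
    rw [Finset.sum_insert hzT, ← Finset.add_sum_erase _ _ hx] at h1
    linarith [hxmin z hzW]

end CommitteeScoring

theorem mainTheorem1 (f : CommitteeScoring.ScoringFamily) :
    CommitteeScoring.IsCommitteeEnlargementMonotone.{u}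
        (CommitteeScoring.committeeScoringRule.{u} f) ↔
      CommitteeScoring.IsSeparableRule.{u} (CommitteeScoring.committeeScoringRule.{u} f) := by
  refine ⟨CommitteeScoring.isSeparableRule_of_isCommitteeEnlargementMonotone, ?_⟩
  rintro ⟨g, hg, h⟩
  rw [h]
  exact CommitteeScoring.isCommitteeEnlargementMonotone_of_isSeparable hg
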